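/- Let $n,p\ge 1$. There are $n$ agents and $p$ categories of items $D_1=\dots=D_p=\{1,\dots,n\}$; a bundle is an element of $\mathfrak D=D_1\times\cdots\times D_p$. A profile $P=(R_1,\dots,R_n)$ consists of one linear order $R_j$ over $\mathfrak D$ for each agent $j$; the rank of a bundle in $R_j$ is its position, the top bundle having rank $1$ and the bottom bundle rank $n^p$. An allocation gives each agent a bundle so that in every category every item is given to exactly one agent. Let $\mathcal O$ be a linear order over $\{1,\dots,n\}\times\{1,\dots,p\}$ and let each agent be either optimistic or pessimistic. The categorial sequential allocation mechanism (CSAM) $f_{\mathcal O}$ runs in $np$ rounds. If the $t$-th element of $\mathcal O$ is $(j,i)$, then in round $t$ agent $j$ takes one of the items of $D_i$ that nobody has taken from $D_i$ before. The bundles available to $j$ at this moment are those that contain the items she has already taken and, in every other category, an item that is still available. An optimistic agent takes the $i$-th component of her most preferred available bundle. A pessimistic agent takes the available item $d\in D_i$ such that, for every other available item $d'\in D_i$, she prefers the worst available bundle with $i$-th component $d$ to the worst available bundle with $i$-th component $d'$. For each agent $j$, let $\mathcal O_j(1),\dots,\mathcal O_j(p)$ be the categories in the order in which $j$ chooses from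 them, and let $k_{j,i}=1+|\{j' : (j',i)\text{ comes after }(j,i)\text{ in }\mathcal O\}|$ be the number of items of $D_i$ that are available right before $j$ chooses from $D_i$. Let $K_j$ be the smallest number in $\{1,\dots,p\}$ such that for every $l$ with $K_j<l\le p$, no agent chooses from category $\mathcal O_j(l)$ between the round in which $j$ chooses from $\mathcal O_j(K_j)$ and the round in which $j$ chooses from $\mathcal O_j(l)$. Theorem. For every $\mathcal O$ and every assignment of the types optimistic/pessimistic to the agents, there is a profile $P$ such that 1. for every optimistic agent $j$, the bundle allocated to her by $f_{\mathcal O}$ at $P$ has rank exactly $n^p+1-\prod_{l=K_j}^{p}k_{j,\mathcal O_j(l)}$ in $R_j$; 2. for every pessimistic agent $j$, the bundle allocated to her by $f_{\mathcal O}$ at $P$ has rank exactly $n^p-\sum_{l=1}^{p}(k_{j,\mathcal O_j(l)}-1)$ in $R_j$; 3. there is an allocation in which at least $n-1$ agents get their top-ranked bundle and the remaining agent gets her top-ranked or second-ranked bundle (with respect to the same profile $P$). -/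

import Mathlib

namespace CSAM

/-- A bundle: one item out of `Fin n` from each of the `p` categories. -/
abbrev Bundle (n p : ℕ) : Type := Fin p → Fin n

/-- A preference: a (strict) linear order over bundles; `R.prefers d e` says that `d` is strictly
preferred to `e`. -/
structure Preference (n p : ℕ) where
  prefers : Bundle n p → Bundle n p → Prop
  strictTotal : IsStrictTotalOrder (Bundle n p) prefers

/-- A preference profile: one preference for each agent. -/
abbrev Profile (n p : ℕ) : Type := Fin n → Preference n p

/-- The rank of a bundle: the most preferred bundle has rank `1`, the least preferred `n ^ p`. -/
noncomputable def Preference.rank {n p : ℕ} (R : Preference n p) (d : Bundle n p) : ℕ :=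
  {e : Bundle n p | R.prefers e d}.ncard + 1

/-- `d` is the most preferred element of `S`. -/
def Preference.IsBest {n p : ℕ} (R : Preference n p) (S : Set (Bundle n p)) (d : Bundle n p) :
    Prop :=
  d ∈ S ∧ ∀ e ∈ S, e ≠ d → R.prefers d e

/-- `d` is the least preferred element of `S`. -/
def Preference.IsWorst {n p : ℕ} (R : Preference n p) (S : Set (Bundle n p)) (d : Bundle n p) :
    Prop :=
  d ∈ S ∧ ∀ e ∈ S, e ≠ d → R.prefers e d

/-- An allocation: every agent gets a bundle, and in each category all items are handed out
(so, by counting, each item goes to exactly one agent). -/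
structure Allocation (n p : ℕ) where
  bundle : Fin n → Bundle n p
  surjective : ∀ i : Fin p, Function.Surjective fun j : Fin n => bundle j i

/-- A linear order over the pairs (agent, category): `O t` is the pair at position `t`, and
`O.symm (j, i)` is the round in which agent `j` chooses from category `i`.
Rounds are numbered from `0`. -/
abbrev Order (n p : ℕ) : Type := Fin (n * p) ≃ Fin n × Fin p

/-- The two types of myopic agents. -/
inductive AgentType : Type
  | optimistic : AgentType
  | pessimistic : AgentType

/-- The items of category `i` still available at the beginning of round `t`, where `A j' i'` is the
item that agent `j'` chooses from category `i'`. -/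
def availableItems {n p : ℕ} (O : Order n p) (A : Fin n → Bundle n p) (t : Fin (n * p))
    (i : Fin p) : Set (Fin n) :=
  {x | ∀ j' : Fin n, O.symm (j', i) < t → A j' i ≠ x}

/-- The bundles still available to agent `j` at the beginning of round `t`, given the items she has
chosen in previous rounds. -/
def availableBundles {n p : ℕ} (O : Order n p) (A : Fin n → Bundle n p) (t : Fin (n * p))
    (j : Fin n) : Set (Bundle n p) :=
  {d | ∀ i : Fin p, (O.symm (j, i) < t → d i = A j i) ∧
    (t ≤ O.symm (j, i) → d i ∈ availableItems O A t i)}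

/-- Item `x` is what an agent with preference `R` chooses from category `i` when `S` is the set of
bundles available to her. The available items of category `i` are exactly the `i`-th components of
the elements of `S`.
* An optimistic agent chooses the item in her best available bundle.
* A pessimistic agent chooses the available item such that she prefers the worst available bundle
  with this item to the worst available bundle with `y`, for every other available item `y`. -/
def Chooses {n p : ℕ} (R : Preference n p) (S : Set (Bundle n p)) (i : Fin p) (x : Fin n) :
    AgentType → Prop
  | .optimistic => ∃ d, R.IsBest S d ∧ d i = x
  | .pessimistic => ∃ d, R.IsWorst {b ∈ S | b i = x} d ∧
      ∀ y, y ≠ x → ∀ e, R.IsWorst {b ∈ S | b i = y} e → R.prefers d e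

/-- `A` records a run of the mechanism: in every round, the item taken by the active agent `j` from
the designated category `i` is the one that she chooses in the situation at the beginning of this
round. -/
def IsRun {n p : ℕ} (O : Order n p) (τ : Fin n → AgentType) (P : Profile n p)
    (A : Fin n → Bundle n p) : Prop :=
  ∀ (j : Fin n) (i : Fin p),
    Chooses (P j) (availableBundles O A (O.symm (j, i)) j) i (A j i) (τ j)

/-! Every profile has exactly one run, and its result is an allocation. -/

theorem Preference.exists_isBest {n p : ℕ} (R : Preference n p) {S : Set (Bundle n p)}
    (hS : S.Nonempty) : ∃ d, R.IsBest S d := by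
  have := R.strictTotal
  obtain ⟨d, hd, hmin⟩ := (Finite.wellFounded_of_trans_of_irrefl R.prefers).has_min S hS
  refine ⟨d, hd, fun e he hne => ?_⟩
  rcases trichotomous_of R.prefers d e with h | h | h
  · exact h
  · exact absurd h.symm hne
  · exact absurd h (hmin e he)

theorem Preference.exists_isWorst {n p : ℕ} (R : Preference n p) {S : Set (Bundle n p)}
    (hS : S.Nonempty) : ∃ d, R.IsWorst S d := by
  have := R.strictTotal
  obtain ⟨d, hd, hmin⟩ :=
    (Finite.wellFounded_of_trans_of_irrefl (Function.swap R.prefers)).has_min S hS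
  refine ⟨d, hd, fun e he hne => ?_⟩
  rcases trichotomous_of R.prefers d e with h | h | h
  · exact absurd h (hmin e he)
  · exact absurd h.symm hne
  · exact h

theorem Preference.not_prefers_both {n p : ℕ} (R : Preference n p) {d e : Bundle n p}
    (h₁ : R.prefers d e) (h₂ : R.prefers e d) : False := by
  have := R.strictTotal
  exact irrefl_of R.prefers d (trans_of R.prefers h₁ h₂)

theorem exists_chooses {n p : ℕ} (R : Preference n p) {S : Set (Bundle n p)} (hS : S.Nonempty)
    (i : Fin p) (τ : AgentType) : ∃ x, Chooses R S i x τ := by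
  cases τ with
  | optimistic =>
    obtain ⟨d, hd⟩ := R.exists_isBest hS
    exact ⟨d i, d, hd, rfl⟩
  | pessimistic =>
    obtain ⟨b, hb⟩ := hS
    obtain ⟨w, hw⟩ := R.exists_isWorst (S := {c ∈ S | c i = b i}) ⟨b, hb, rfl⟩
    obtain ⟨d, ⟨x, hd⟩, hbest⟩ :=
      R.exists_isBest (S := {w | ∃ y, R.IsWorst {c ∈ S | c i = y} w}) ⟨w, b i, hw⟩
    refine ⟨x, d, hd, fun y hy e he => hbest e ⟨y, he⟩ ?_⟩
    rintro rfl
    exact hy (he.1.2.symm.trans hd.1.2)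

theorem chooses_unique {n p : ℕ} {R : Preference n p} {S : Set (Bundle n p)} {i : Fin p}
    {τ : AgentType} {x y : Fin n} (hx : Chooses R S i x τ) (hy : Chooses R S i y τ) : x = y := by
  by_contra hne
  cases τ with
  | optimistic =>
    obtain ⟨d, hd, rfl⟩ := hx
    obtain ⟨e, he, rfl⟩ := hy
    have hde : e ≠ d := by
      rintro rfl
      exact hne rfl
    exact R.not_prefers_both (hd.2 e he.1 hde) (he.2 d hd.1 hde.symm)
  | pessimistic =>
    obtain ⟨d, hd, hd'⟩ := hx
    obtain ⟨e, he, he'⟩ := hy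
    exact R.not_prefers_both (hd' y (Ne.symm hne) e he) (he' x hne d hd)

theorem chooses_mem {n p : ℕ} {R : Preference n p} {S : Set (Bundle n p)} {i : Fin p}
    {τ : AgentType} {x : Fin n} (hx : Chooses R S i x τ) : ∃ d ∈ S, d i = x := by
  cases τ with
  | optimistic =>
    obtain ⟨d, hd, h⟩ := hx
    exact ⟨d, hd.1, h⟩
  | pessimistic =>
    obtain ⟨d, hd, -⟩ := hx
    exact ⟨d, hd.1.1, hd.1.2⟩

theorem availableBundles_congr {n p : ℕ} {O : Order n p} {A B : Fin n → Bundle n p}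
    {t : Fin (n * p)} (j : Fin n) (h : ∀ j' i', O.symm (j', i') < t → A j' i' = B j' i') :
    availableBundles O A t j = availableBundles O B t j := by
  have hI : ∀ i, availableItems O A t i = availableItems O B t i := by
    intro i
    ext x
    exact forall_congr' fun j' => forall_congr' fun hj' => by rw [h j' i hj']
  ext d
  refine forall_congr' fun i => ?_
  rw [hI i]
  exact and_congr_left fun _ => forall_congr' fun hi => by rw [h j i hi]

theorem availableBundles_nonempty {n p : ℕ} (O : Order n p) (A : Fin n → Bundle n p)
    (t : Fin (n * p)) (j : Fin n) : (availableBundles O A t j).Nonempty := by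
  have key : ∀ i, ∃ x, (O.symm (j, i) < t → x = A j i) ∧
      (t ≤ O.symm (j, i) → x ∈ availableItems O A t i) := by
    intro i
    by_cases hi : O.symm (j, i) < t
    · exact ⟨A j i, fun _ => rfl, fun h => absurd h (not_le.mpr hi)⟩
    · by_contra hcon
      push Not at hcon
      have hsurj : Function.Surjective fun j' : {j' : Fin n // j' ≠ j} => A j' i := by
        intro x
        have hx := (hcon x fun h => absurd h hi).2
        simp only [availableItems, Set.mem_ofPred_eq, not_forall, not_not] at hx
        obtain ⟨j', hj', rfl⟩ := hx
        refine ⟨⟨j', ?_⟩, rfl⟩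
        rintro rfl
        exact hi hj'
      have hcard := Fintype.card_le_of_surjective _ hsurj
      rw [Fintype.card_subtype_compl, Fintype.card_fin, Fintype.card_unique] at hcard
      have := j.pos
      omega
  choose d hd using key
  exact ⟨d, hd⟩

theorem existsUnique_isRun {n p : ℕ} (O : Order n p) (τ : Fin n → AgentType) (P : Profile n p) :
    ∃! A : Fin n → Bundle n p, IsRun O τ P A := by
  classical
  have step : ∀ m : ℕ, ∃ A : Fin n → Bundle n p, ∀ j i, (O.symm (j, i) : ℕ) < m →
      Chooses (P j) (availableBundles O A (O.symm (j, i)) j) i (A j i) (τ j) := by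
    intro m
    induction m with
    | zero => exact ⟨fun j _ => j, fun j i h => absurd h (Nat.not_lt_zero _)⟩
    | succ m ih =>
      obtain ⟨A, hA⟩ := ih
      by_cases hm : m < n * p
      · obtain ⟨⟨j₀, i₀⟩, h₀⟩ : ∃ q, O ⟨m, hm⟩ = q := ⟨_, rfl⟩
        have h₀' : O.symm (j₀, i₀) = ⟨m, hm⟩ := by rw [← h₀, Equiv.symm_apply_apply]
        obtain ⟨x, hx⟩ := exists_chooses (P j₀) (availableBundles_nonempty O A ⟨m, hm⟩ j₀) i₀ (τ j₀)
        let B : Fin n → Bundle n p := fun j i => if (j, i) = (j₀, i₀) then x else A j i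
        have hBA : ∀ j i, O.symm (j, i) ≠ ⟨m, hm⟩ → A j i = B j i := by
          intro j i h
          have : (j, i) ≠ (j₀, i₀) := by
            intro hq
            exact h (by rw [hq, h₀'])
          simp only [B, if_neg this]
        refine ⟨B, fun j i hji => ?_⟩
        have hcongr : availableBundles O A (O.symm (j, i)) j =
            availableBundles O B (O.symm (j, i)) j :=
          availableBundles_congr j fun j' i' h => hBA j' i' fun heq => by
            have h2 : (O.symm (j', i') : ℕ) < O.symm (j, i) := h
            rw [heq] at h2
            simp only at h2
            omega
        rw [← hcongr]
        by_cases hq : O.symm (j, i) = ⟨m, hm⟩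
        · have hpair : (j, i) = (j₀, i₀) := O.symm.injective (hq.trans h₀'.symm)
          have hB : B j i = x := by simp only [B, if_pos hpair]
          obtain ⟨rfl, rfl⟩ := Prod.mk.inj hpair
          rw [hB, hq]
          exact hx
        · rw [← hBA j i hq]
          refine hA j i ?_
          have : (O.symm (j, i) : ℕ) ≠ m := fun h => hq (Fin.ext h)
          omega
      · refine ⟨A, fun j i h => hA j i ?_⟩
        have := (O.symm (j, i)).isLt
        omega
  obtain ⟨A, hA⟩ := step (n * p)
  refine ⟨A, fun j i => hA j i (O.symm (j, i)).isLt, fun B hB => ?_⟩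
  have huniq : ∀ m : ℕ, ∀ j i, (O.symm (j, i) : ℕ) = m → B j i = A j i := by
    intro m
    induction m using Nat.strong_induction_on with
    | _ m ih =>
      intro j i hji
      have hc := hB j i
      rw [availableBundles_congr (B := A) j fun j' i' h =>
        ih (O.symm (j', i')) (hji ▸ h) j' i' rfl] at hc
      exact chooses_unique hc (hA j i (O.symm (j, i)).isLt)
  funext j i
  exact huniq _ j i rfl

theorem IsRun.surjective {n p : ℕ} {O : Order n p} {τ : Fin n → AgentType} {P : Profile n p}
    {A : Fin n → Bundle n p} (hA : IsRun O τ P A) (i : Fin p) :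
    Function.Surjective fun j : Fin n => A j i := by
  have hlt : ∀ j j', O.symm (j', i) < O.symm (j, i) → A j' i ≠ A j i := by
    intro j j' h
    obtain ⟨d, hd, hdi⟩ := chooses_mem (hA j i)
    have := (hd i).2 le_rfl j' h
    rwa [hdi] at this
  refine Finite.surjective_of_injective fun j j' h => ?_
  by_contra hne
  have hne' : O.symm (j, i) ≠ O.symm (j', i) := fun h' =>
    hne (Prod.mk.inj (O.symm.injective h')).1
  rcases lt_or_gt_of_ne hne' with hl | hl
  · exact hlt j' j hl h
  · exact hlt j j' hl h.symm

/-- The categorial sequential allocation mechanism given by `O`, for agents of types `τ`: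
it maps a profile to the allocation that results from the run. -/
noncomputable def mechanism {n p : ℕ} (O : Order n p) (τ : Fin n → AgentType) (P : Profile n p) :
    Allocation n p where
  bundle := (existsUnique_isRun O τ P).choose
  surjective := (existsUnique_isRun O τ P).choose_spec.1.surjective

/-- The order in which agent `j` chooses from the categories: `categoryOrder O j l` is the category
from which she makes her `l`-th choice (counted from `0`). -/
def categoryOrder {n p : ℕ} (O : Order n p) (j : Fin n) : Equiv.Perm (Fin p) :=
  Tuple.sort fun i : Fin p => O.symm (j, i)

/-- The number of items of category `i` that are still available right before agent `j` chooses
from this category: one plus the number of agents who choose from it later. -/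
def numAvailable {n p : ℕ} (O : Order n p) (j : Fin n) (i : Fin p) : ℕ :=
  1 + (Finset.univ.filter fun j' : Fin n => O.symm (j, i) < O.symm (j', i)).card

/-- After agent `j` has made her choice number `m` (counted from `0`), no agent interrupts her: for
each of her later choices, say from category `c`, no agent chooses from `c` between her choice
number `m` and her choice from `c`. -/
def Uninterrupted {n p : ℕ} (O : Order n p) (j : Fin n) (m : Fin p) : Prop :=
  ∀ l : Fin p, m < l → ∀ j' : Fin n,
    ¬ (O.symm (j, categoryOrder O j m) < O.symm (j', categoryOrder O j l) ∧
      O.symm (j', categoryOrder O j l) < O.symm (j, categoryOrder O j l))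

/-- The smallest index (counted from `0`) of a choice of agent `j` after which she is not
interrupted. For `0 < p` it exists, since her last choice is such a choice. -/
noncomputable def criticalIndex {n p : ℕ} (O : Order n p) (j : Fin n) : ℕ :=
  sInf {m : ℕ | ∃ h : m < p, Uninterrupted O j ⟨m, h⟩}

end CSAM

/-! Items may be named so that agent `j` takes item `j` from every category; the target of the run
is `b = constBundle j`. It remains to find, for each agent separately, a preference that makes her
follow this run, puts `b` at the required rank, and puts `g = constBundle (σ j)` on top (or second,
for one agent). The permutation `σ` sends an agent to the one whose first choice directly precedes
hers, and the agent `j₀` who starts the mechanism to the last one. For `j ≠ j₀`, one item of `g` is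
gone before `j` makes any choice, so placing `g` on top does not influence her.

Optimistic agent: from her critical choice on, the bundles available to her lie in the set
`lastingBundles`, whose size is the product. This set goes to the bottom of her order, with `b` as
its best element. Before that choice she is lured by a bait: a bundle agreeing with `b` in the
categories she has yet to pass, but containing an item that another agent takes just before the
critical choice (`exists_critical`, `exists_suitable_optimistic`).

Pessimistic agent: below `b` it is enough to put the bundles that differ from `b` in one item still
available at her turn, with exchanges in earlier categories worse. Deviating from item `j` now then
risks a worse outcome than any that remains possible after taking `j`
(`exists_suitable_pessimistic`). -/

namespace CSAM

/-! ### Preferences defined by numerical keys, and ranks -/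

/-- A smaller key means more preferred; ties are broken by an arbitrary enumeration of the bundles,
so the keys below need only separate what matters. -/
theorem exists_preference_of_key {n p : ℕ} (κ : Bundle n p → ℕ) :
    ∃ R : Preference n p, ∀ d e, κ d < κ e → R.prefers d e := by
  let f : Bundle n p → ℕ ×ₗ Fin (Fintype.card (Bundle n p)) :=
    fun d => toLex (κ d, Fintype.equivFin _ d)
  have hf : Function.Injective f := fun d e h => by
    have h' : (κ d, Fintype.equivFin _ d) = (κ e, Fintype.equivFin _ e) := toLex.injective h
    exact (Fintype.equivFin _).injective (Prod.mk.inj h').2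
  refine ⟨⟨fun d e => f d < f e,
    (RelEmbedding.preimage ⟨f, hf⟩ (· < ·)).isStrictTotalOrder⟩, fun d e h => ?_⟩
  exact Prod.Lex.toLex_lt_toLex.2 (Or.inl h)

theorem Preference.rank_add_card {n p : ℕ} (R : Preference n p) {b : Bundle n p}
    {L : Finset (Bundle n p)} (hb : b ∉ L) (hL : ∀ d ∈ L, R.prefers b d)
    (hU : ∀ d, d ∉ L → d ≠ b → R.prefers d b) : R.rank b + L.card = n ^ p := by
  classical
  have hset : {e : Bundle n p | R.prefers e b} = ((insert b L)ᶜ : Finset (Bundle n p)) := by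
    ext d
    simp only [Set.mem_ofPred_eq, Finset.coe_compl, Set.mem_compl_iff, Finset.mem_coe,
      Finset.mem_insert, not_or]
    refine ⟨fun h => ⟨?_, fun hd => R.not_prefers_both h (hL d hd)⟩, fun h => hU d h.2 h.1⟩
    rintro rfl
    exact R.not_prefers_both h h
  have hle : (insert b L).card ≤ Fintype.card (Bundle n p) := Finset.card_le_univ _
  have hcard : Fintype.card (Bundle n p) = n ^ p := by simp
  rw [Finset.card_insert_of_notMem hb] at hle
  rw [Preference.rank, hset, Set.ncard_coe_finset, Finset.card_compl,
    Finset.card_insert_of_notMem hb]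
  omega

theorem Preference.rank_eq_one {n p : ℕ} (R : Preference n p) {g : Bundle n p}
    (h : ∀ d, d ≠ g → R.prefers g d) : R.rank g = 1 := by
  have : {e : Bundle n p | R.prefers e g} = ∅ := by
    refine Set.eq_empty_of_forall_notMem fun d hd => ?_
    by_cases hdg : d = g
    · subst hdg
      exact R.not_prefers_both hd hd
    · exact R.not_prefers_both hd (h d hdg)
  rw [Preference.rank, this, Set.ncard_empty]

theorem Preference.rank_eq_one_or_two {n p : ℕ} (R : Preference n p) {g e : Bundle n p}
    (h : ∀ d, d ≠ g → d ≠ e → R.prefers g d) : R.rank g = 1 ∨ R.rank g = 2 := by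
  have hsub : {e : Bundle n p | R.prefers e g} ⊆ {e} := fun d hd => by
    by_contra hde
    by_cases hdg : d = g
    · subst hdg
      exact R.not_prefers_both hd hd
    · exact R.not_prefers_both hd (h d hdg hde)
  have := Set.ncard_le_ncard hsub
  rw [Set.ncard_singleton] at this
  rw [Preference.rank]
  omega

/-- Sort by `f` and rotate cyclically: `σ` is the predecessor map, and the minimum `j₀` is sent to
the maximum. -/
theorem exists_perm_lt {n : ℕ} (hn : 1 ≤ n) {α : Type*} [LinearOrder α] (f : Fin n → α)
    (hf : Function.Injective f) :
    ∃ (j₀ : Fin n) (σ : Equiv.Perm (Fin n)), (∀ j, f j₀ ≤ f j) ∧ (∀ j, j ≠ j₀ → f (σ j) < f j) ∧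
      (σ j₀ = j₀ → n = 1) := by
  obtain ⟨m, rfl⟩ : ∃ m, n = m + 1 := ⟨n - 1, by omega⟩
  let s := Tuple.sort f
  have hmono : StrictMono (f ∘ s) :=
    (Tuple.monotone_sort f).strictMono_of_injective (hf.comp s.injective)
  refine ⟨s 0, (s.symm.trans (finRotate (m + 1)).symm).trans s, fun j => ?_, fun j hj => ?_,
    fun h => ?_⟩
  · have := hmono.monotone (Fin.zero_le (s.symm j))
    simpa using this
  · have h0 : s.symm j ≠ 0 := fun h => hj (by rw [← h, Equiv.apply_symm_apply])
    obtain ⟨k, hk⟩ := Fin.exists_succ_eq.2 h0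
    have hk' : (finRotate (m + 1)).symm (s.symm j) = k.castSucc := by
      rw [Equiv.symm_apply_eq, ← hk, finRotate_apply, Fin.coeSucc_eq_succ]
    have := hmono (Fin.castSucc_lt_succ (i := k))
    simp only [Function.comp_apply] at this
    simp only [Equiv.trans_apply, hk']
    rwa [hk, Equiv.apply_symm_apply] at this
  · simp only [Equiv.trans_apply, Equiv.symm_apply_apply, EmbeddingLike.apply_eq_iff_eq] at h
    rw [Equiv.symm_apply_eq, finRotate_apply] at h
    have := congrArg Fin.val h
    rcases m with _ | m
    · rfl
    · simp at this

/-! ### The run in which every agent takes her own item -/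

/-- The bundle that consists of item `j` in every category. -/
def constBundle {n p : ℕ} (j : Fin n) : Bundle n p := fun _ => j

/-- In this run item `x` of category `i` disappears in round `O.symm (x, i)`, so availability is a
comparison of rounds. -/
theorem mem_availableBundles_const {n p : ℕ} {O : Order n p} {t : Fin (n * p)} {j : Fin n}
    {d : Bundle n p} : d ∈ availableBundles O constBundle t j ↔
      ∀ i, (O.symm (j, i) < t → d i = j) ∧ (t ≤ O.symm (j, i) → t ≤ O.symm (d i, i)) := by
  refine forall_congr' fun i => and_congr Iff.rfl (imp_congr Iff.rfl ?_)
  constructor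
  · intro h
    by_contra hlt
    exact h (d i) (not_le.1 hlt) rfl
  · rintro h j' hj' rfl
    exact absurd h (not_le.2 hj')

theorem constBundle_mem {n p : ℕ} (O : Order n p) (t : Fin (n * p)) (j : Fin n) :
    constBundle j ∈ availableBundles O constBundle t j :=
  mem_availableBundles_const.2 fun _ => ⟨fun _ => rfl, id⟩

theorem symm_inj {n p : ℕ} {O : Order n p} {j j' : Fin n} {i i' : Fin p}
    (h : O.symm (j, i) = O.symm (j', i')) : j = j' ∧ i = i' :=
  Prod.mk.inj (O.symm.injective h)

theorem mechanism_bundle_eq {n p : ℕ} {O : Order n p} {τ : Fin n → AgentType}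
    {P : Profile n p} {A : Fin n → Bundle n p} (hA : IsRun O τ P A) :
    (mechanism O τ P).bundle = A :=
  (existsUnique_isRun O τ P).unique (existsUnique_isRun O τ P).choose_spec.1 hA

theorem numAvailable_eq_card {n p : ℕ} (O : Order n p) (j : Fin n) (i : Fin p) :
    numAvailable O j i =
      (Finset.univ.filter fun x : Fin n => O.symm (j, i) ≤ O.symm (x, i)).card := by
  have : (Finset.univ.filter fun x : Fin n => O.symm (j, i) ≤ O.symm (x, i)) =
      insert j (Finset.univ.filter fun x : Fin n => O.symm (j, i) < O.symm (x, i)) := by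
    ext x
    simp only [Finset.mem_filter, Finset.mem_univ, true_and, Finset.mem_insert]
    rw [le_iff_eq_or_lt]
    refine or_congr_left ⟨fun h => (symm_inj h).1.symm, ?_⟩
    rintro rfl
    rfl
  rw [this, Finset.card_insert_of_notMem (by simp), numAvailable, add_comm]

/-! ### The sets placed at the bottom, and their sizes -/

/-- The bundles obtained from `constBundle j` by exchanging one item for an item that is available
when agent `j` chooses from its category. -/
noncomputable def singleExchanges {n p : ℕ} (O : Order n p) (j : Fin n) :
    Finset (Bundle n p) :=
  (Finset.univ.sigma fun i : Fin p =>
    Finset.univ.filter fun x : Fin n => O.symm (j, i) < O.symm (x, i)).image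
      fun q => Function.update (constBundle j) q.1 q.2

theorem mem_singleExchanges {n p : ℕ} {O : Order n p} {j : Fin n} {d : Bundle n p} :
    d ∈ singleExchanges O j ↔
      ∃ i x, O.symm (j, i) < O.symm (x, i) ∧ d = Function.update (constBundle j) i x := by
  simp only [singleExchanges, Finset.mem_image, Finset.mem_sigma, Finset.mem_univ, true_and,
    Finset.mem_filter, Sigma.exists]
  exact exists_congr fun i => exists_congr fun x => and_congr Iff.rfl eq_comm

theorem card_singleExchanges {n p : ℕ} (O : Order n p) (j : Fin n) :
    (singleExchanges O j).card + p = ∑ i, numAvailable O j i := by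
  rw [singleExchanges, Finset.card_image_of_injOn, Finset.card_sigma]
  · simp only [numAvailable, Finset.sum_add_distrib]
    simp [add_comm]
  · rintro ⟨i, x⟩ hx ⟨i', x'⟩ hx' h
    simp only [Finset.coe_sigma, Set.mem_sigma_iff, Finset.coe_filter, Finset.mem_univ,
      true_and, Set.mem_ofPred_eq] at hx hx' h
    -- An exchanged item differs from `j`, so the bundle reveals where the exchange happened.
    have hxj : x ≠ j := by
      rintro rfl
      exact lt_irrefl _ hx.2
    have h1 := congrFun h i
    rw [Function.update_self] at h1
    by_cases hi : i = i'
    · subst hi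
      rw [Function.update_self] at h1
      rw [h1]
    · rw [Function.update_of_ne hi] at h1
      exact absurd h1 hxj

/-- The bundles that are available to agent `j` in round `t` and do not become unavailable before
she chooses, if she has chosen item `j` in all earlier rounds. -/
noncomputable def lastingBundles {n p : ℕ} (O : Order n p) (j : Fin n) (t : Fin (n * p)) :
    Finset (Bundle n p) :=
  Fintype.piFinset fun i => if O.symm (j, i) < t then {j} else
    Finset.univ.filter fun x : Fin n => O.symm (j, i) ≤ O.symm (x, i)

theorem mem_lastingBundles {n p : ℕ} {O : Order n p} {j : Fin n} {t : Fin (n * p)}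
    {d : Bundle n p} : d ∈ lastingBundles O j t ↔
      ∀ i, (O.symm (j, i) < t → d i = j) ∧
        (t ≤ O.symm (j, i) → O.symm (j, i) ≤ O.symm (d i, i)) := by
  rw [lastingBundles, Fintype.mem_piFinset]
  refine forall_congr' fun i => ?_
  split_ifs with h
  · simp [h, not_le.2 h]
  · simp [h, not_lt.1 h]

theorem card_lastingBundles {n p : ℕ} (O : Order n p) (j : Fin n) (t : Fin (n * p)) :
    (lastingBundles O j t).card =
      ∏ i ∈ Finset.univ.filter (fun i => t ≤ O.symm (j, i)), numAvailable O j i := by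
  rw [lastingBundles, Fintype.card_piFinset, Finset.prod_filter]
  refine Finset.prod_congr rfl fun i _ => ?_
  by_cases h : O.symm (j, i) < t
  · rw [if_pos h, if_neg (not_le.2 h), Finset.card_singleton]
  · rw [if_neg h, if_pos (not_lt.1 h), numAvailable_eq_card]

/-! ### The critical choice of an agent -/

theorem strictMono_categoryOrder {n p : ℕ} (O : Order n p) (j : Fin n) :
    StrictMono fun l => O.symm (j, categoryOrder O j l) :=
  (Tuple.monotone_sort fun i : Fin p => O.symm (j, i)).strictMono_of_injective
    fun _ _ h => (categoryOrder O j).injective (symm_inj h).2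

/-- Here `c` is the category of choice `criticalIndex O j`. The second clause is uninterruptedness
after `c`. The third is minimality: unless `c` comes first, some `j'` interrupts between the
preceding choice and `c`; the pair `i'`, `j'` supplies the bait. -/
theorem exists_critical {n p : ℕ} (hp : 1 ≤ p) (O : Order n p) (j : Fin n) :
    ∃ c : Fin p,
      (∏ l ∈ Finset.univ.filter (fun l : Fin p => criticalIndex O j ≤ (l : ℕ)),
          numAvailable O j (categoryOrder O j l) =
        (lastingBundles O j (O.symm (j, c))).card) ∧
      (∀ i j', O.symm (j, c) ≤ O.symm (j, i) → O.symm (j, c) ≤ O.symm (j', i) →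
        O.symm (j, i) ≤ O.symm (j', i)) ∧
      ((∀ i, O.symm (j, c) ≤ O.symm (j, i)) ∨
        ∃ i' j', O.symm (j, c) ≤ O.symm (j, i') ∧ O.symm (j', i') < O.symm (j, c) ∧
          ∀ i, O.symm (j, i) < O.symm (j, c) → O.symm (j, i) < O.symm (j', i')) := by
  have hmono := strictMono_categoryOrder O j
  have hne : {m : ℕ | ∃ h : m < p, Uninterrupted O j ⟨m, h⟩}.Nonempty :=
    ⟨p - 1, by omega, fun l hl => by
      have := l.isLt
      have : p - 1 < (l : ℕ) := hl
      omega⟩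
  obtain ⟨hK, hun⟩ : ∃ h : criticalIndex O j < p, Uninterrupted O j ⟨criticalIndex O j, h⟩ :=
    Nat.sInf_mem hne
  have hmin : ∀ m, m < criticalIndex O j → ∀ h : m < p, ¬ Uninterrupted O j ⟨m, h⟩ :=
    fun m hm h hu => Nat.notMem_of_lt_sInf hm ⟨h, hu⟩
  generalize criticalIndex O j = K at *
  have hle : ∀ l : Fin p, O.symm (j, categoryOrder O j ⟨K, hK⟩) ≤
      O.symm (j, categoryOrder O j l) ↔ K ≤ (l : ℕ) := fun l => hmono.le_iff_le
  have hunint : ∀ i j', O.symm (j, categoryOrder O j ⟨K, hK⟩) ≤ O.symm (j, i) →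
      O.symm (j, categoryOrder O j ⟨K, hK⟩) ≤ O.symm (j', i) → O.symm (j, i) ≤ O.symm (j', i) := by
    intro i j' h1 h2
    obtain ⟨l, rfl⟩ := (categoryOrder O j).surjective i
    rcases (show (⟨K, hK⟩ : Fin p) ≤ l from (hle l).1 h1).eq_or_lt with rfl | h
    · exact h2
    · by_contra hlt
      refine hun l h j' ⟨lt_of_le_of_ne h2 fun heq => ?_, not_le.1 hlt⟩
      exact h.ne ((categoryOrder O j).injective (symm_inj heq).2)
  refine ⟨categoryOrder O j ⟨K, hK⟩, ?_, hunint, ?_⟩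
  · rw [card_lastingBundles, Finset.prod_filter, Finset.prod_filter]
    conv_rhs => rw [← Equiv.prod_comp (categoryOrder O j)]
    simp only [hle]
  · rcases Nat.eq_zero_or_pos K with h0 | h0
    · left
      intro i
      obtain ⟨l, rfl⟩ := (categoryOrder O j).surjective i
      exact (hle l).2 (by omega)
    · right
      have hnot := hmin (K - 1) (by omega) (by omega)
      simp only [Uninterrupted, not_forall, not_not] at hnot
      obtain ⟨l, hl, j', h1, h2⟩ := hnot
      have hl' : K ≤ (l : ℕ) := by
        have : K - 1 < (l : ℕ) := hl
        omega
      refine ⟨categoryOrder O j l, j', (hle l).2 hl', ?_, fun i hi => ?_⟩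
      -- The interruption happens before round `(j, c)`, since none is possible later.
      · by_contra hlt
        exact absurd (hunint _ j' ((hle l).2 hl') (not_lt.1 hlt)) (not_le.2 h2)
      · obtain ⟨m, rfl⟩ := (categoryOrder O j).surjective i
        refine lt_of_le_of_lt (hmono.monotone ?_) h1
        have : m < (⟨K, hK⟩ : Fin p) := hmono.lt_iff_lt.1 hi
        rw [Fin.lt_def] at this
        rw [Fin.le_def]
        simp only at this ⊢
        omega

/-! ### Constructing the preference of a single agent -/

/-- What the preference `R` of agent `j` has to satisfy if `g` is the bundle intended for her in the
alternative allocation: while the bundles `constBundle j'` are handed out, she chooses item `j` from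
all categories, and `g` is her top bundle, or one of her two top bundles if she chooses first. -/
def IsSuitable {n p : ℕ} (O : Order n p) (j₀ j : Fin n) (g : Bundle n p) (τ : AgentType)
    (R : Preference n p) : Prop :=
  (∀ i, Chooses R (availableBundles O constBundle (O.symm (j, i)) j) i j τ) ∧
    (j ≠ j₀ → R.rank g = 1) ∧ (R.rank g = 1 ∨ R.rank g = 2)

theorem exists_suitable_optimistic {n p : ℕ} (hp : 1 ≤ p) (O : Order n p) {j₀ j k : Fin n}
    (hfirst : j = j₀ → ∀ j' i', ∃ i, O.symm (j, i) ≤ O.symm (j', i'))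
    (hk₀ : k = j → n = 1)
    (hk : j ≠ j₀ → ∃ i', ∀ i, O.symm (k, i') < O.symm (j, i)) :
    ∃ R : Preference n p, IsSuitable O j₀ j (constBundle k) .optimistic R ∧
      R.rank (constBundle j) +
        ∏ l ∈ Finset.univ.filter (fun l : Fin p => criticalIndex O j ≤ (l : ℕ)),
          numAvailable O j (categoryOrder O j l) = n ^ p + 1 := by
  classical
  obtain ⟨c, hprod, hunint, hcase⟩ := exists_critical hp O j
  rw [hprod]
  set U := lastingBundles O j (O.symm (j, c)) with hU
  have hbU : constBundle j ∈ U := mem_lastingBundles.2 fun i => ⟨fun _ => rfl, fun _ => le_rfl⟩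
  obtain ⟨e, he⟩ : ∃ e : Bundle n p, (∀ i, O.symm (j, c) ≤ O.symm (j, i)) ∨ (e ∉ U ∧
      ∃ i₁, O.symm (j, i₁) < O.symm (j, c) ∧ ∀ i, O.symm (j, i) < O.symm (j, c) →
        e ∈ availableBundles O constBundle (O.symm (j, i)) j ∧ e i = j) := by
    by_cases hall : ∀ i, O.symm (j, c) ≤ O.symm (j, i)
    -- No bait is needed if `c` is the first choice; the value of `e` is a dummy.
    · exact ⟨constBundle j, Or.inl hall⟩
    · obtain ⟨i', j', h1, h2, h3⟩ := hcase.resolve_left hall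
      simp only [not_forall, not_le] at hall
      obtain ⟨i₁, hi₁⟩ := hall
      -- The bait: it survives all choices of `j` before `c` and is destroyed by `j'` before round
      -- `(j, c)`.
      refine ⟨Function.update (constBundle j) i' j', Or.inr ⟨fun hmem => ?_, i₁, hi₁,
        fun i hi => ⟨mem_availableBundles_const.2 fun i₂ => ?_, ?_⟩⟩⟩
      · have := (mem_lastingBundles.1 hmem i').2 h1
        rw [Function.update_self] at this
        exact absurd (h1.trans this) (not_le.2 h2)
      · by_cases h : i₂ = i'
        · subst h
          rw [Function.update_self]
          exact ⟨fun h => absurd (h1.trans h.le) (not_le.2 hi), fun _ => (h3 i hi).le⟩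
        · rw [Function.update_of_ne h]
          exact ⟨fun _ => rfl, id⟩
      · rw [Function.update_of_ne]
        · rfl
        · rintro rfl
          exact absurd h1 (not_le.2 hi)
  set b : Bundle n p := constBundle j with hb
  set g : Bundle n p := constBundle k with hg
  -- From the top: `g` if `j ≠ j₀`, the bait `e`, `g` if `j = j₀`, the rest outside `U`, then `b`,
  -- then the rest of `U`. For `j₀` the bundle `g` may be available, so it must stay below `e`; if
  -- it lies in `U`, it comes first after `b`.
  let κ : Bundle n p → ℕ := fun d =>
    if d = b then 4 else if d ∈ U then (if d = g then 5 else 6) else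
      if d = g then (if j = j₀ then 2 else 0) else if d = e then 1 else 3
  obtain ⟨R, hR⟩ := exists_preference_of_key κ
  -- In category `i'` agent `k` has taken item `k` before `j` chooses anything.
  have hgS : j ≠ j₀ → ∀ i, g ∉ availableBundles O constBundle (O.symm (j, i)) j := by
    intro hj i hmem
    obtain ⟨i', hi'⟩ := hk hj
    rcases lt_or_ge (O.symm (j, i')) (O.symm (j, i)) with h | h
    · have hkj : k = j := (mem_availableBundles_const.1 hmem i').1 h
      have := hi' i'
      rw [hkj] at this
      exact lt_irrefl _ this
    · exact absurd ((mem_availableBundles_const.1 hmem i').2 h) (not_le.2 (hi' i))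
  have hSU : ∀ i, O.symm (j, c) ≤ O.symm (j, i) →
      ∀ d ∈ availableBundles O constBundle (O.symm (j, i)) j, d ∈ U := by
    intro i hi d hd
    refine mem_lastingBundles.2 fun i₂ => ⟨fun h =>
      (mem_availableBundles_const.1 hd i₂).1 (h.trans_le hi), fun h => ?_⟩
    rcases lt_or_ge (O.symm (j, i₂)) (O.symm (j, i)) with h' | h'
    · rw [(mem_availableBundles_const.1 hd i₂).1 h']
    · exact hunint i₂ (d i₂) h (hi.trans ((mem_availableBundles_const.1 hd i₂).2 h'))
  have hUS : ∀ d ∈ U, d ∈ availableBundles O constBundle (O.symm (j, c)) j := fun d hd =>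
    mem_availableBundles_const.2 fun i => ⟨(mem_lastingBundles.1 hd i).1, fun h =>
      h.trans ((mem_lastingBundles.1 hd i).2 h)⟩
  have hone : j ≠ j₀ → R.rank g = 1 := fun hj => by
    have hgU : g ∉ U := fun h => hgS hj c (hUS g h)
    have hgb : g ≠ b := fun h => hgU (h ▸ hbU)
    refine R.rank_eq_one fun d hd => hR _ _ ?_
    simp only [κ, if_neg hgb, if_neg hgU, if_pos, if_neg hj, if_neg hd]
    split_ifs <;> omega
  refine ⟨R, ⟨fun i => ?_, hone, ?_⟩, ?_⟩
  · rcases le_or_gt (O.symm (j, c)) (O.symm (j, i)) with hi | hi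
    · refine ⟨b, ⟨constBundle_mem O _ j, fun d hd hdb => hR _ _ ?_⟩, rfl⟩
      simp only [κ, if_pos, if_neg hdb, if_pos (hSU i hi d hd)]
      split_ifs <;> omega
    · obtain ⟨heU, -, -, hmem⟩ := he.resolve_left fun h => absurd (h i) (not_le.2 hi)
      have heb : e ≠ b := fun h => heU (h ▸ hbU)
      refine ⟨e, ⟨(hmem i hi).1, fun d hd hde => hR _ _ ?_⟩, (hmem i hi).2⟩
      by_cases hj : j = j₀
      · simp only [κ, if_neg heb, if_neg heU, if_pos, if_pos hj, if_neg hde]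
        by_cases heg : e = g
        · have hdg : d ≠ g := fun h => hde (h.trans heg.symm)
          simp only [if_pos heg, if_neg hdg]
          split_ifs <;> omega
        · rw [if_neg heg]
          split_ifs <;> omega
      · have hdg : d ≠ g := fun h => hgS hj i (h ▸ hd)
        have heg : e ≠ g := fun h => hgS hj i (h ▸ (hmem i hi).1)
        simp only [κ, if_neg heb, if_neg heU, if_pos, if_neg hde, if_neg hdg, if_neg heg]
        split_ifs <;> omega
  · by_cases hj : j = j₀
    swap
    · exact Or.inl (hone hj)
    by_cases hkj : k = j
    · have hn := hk₀ hkj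
      subst hn
      exact Or.inl (R.rank_eq_one fun d hd => absurd (Subsingleton.elim d g) hd)
    have hgb : g ≠ b := fun h => hkj (congrFun h c)
    rcases he with hall | ⟨heU, i₁, hi₁, -⟩
    -- Here `(j, c)` is the very first round, so nothing is taken yet and `U` is everything: `b` is
    -- first and `g` second.
    · have hUuniv : ∀ d, d ∈ U := fun d => mem_lastingBundles.2 fun i =>
        ⟨fun h => absurd (hall i) (not_le.2 h), fun h => hunint i (d i) h (by
          obtain ⟨i₂, hi₂⟩ := hfirst hj (d i) i
          exact (hall i₂).trans hi₂)⟩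
      refine R.rank_eq_one_or_two (e := b) fun d hdg hdb => hR _ _ ?_
      simp only [κ, if_neg hgb, if_pos (hUuniv _), if_pos, if_neg hdg, if_neg hdb]
      omega
    · have hgU : g ∉ U := fun h => hkj ((mem_lastingBundles.1 h i₁).1 hi₁)
      refine R.rank_eq_one_or_two (e := e) fun d hdg hde => hR _ _ ?_
      simp only [κ, if_neg hgb, if_neg hgU, if_pos, if_neg hdg, if_neg hde, if_pos hj]
      split_ifs <;> omega
  · have := R.rank_add_card (b := b) (L := U.erase b) (Finset.notMem_erase _ _)
      (fun d hd => hR _ _ (by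
        obtain ⟨hdb, hdU⟩ := Finset.mem_erase.1 hd
        simp only [κ, if_pos, if_neg hdb, if_pos hdU]
        split_ifs <;> omega))
      (fun d hd hdb => hR _ _ (by
        have hdU : d ∉ U := fun h => hd (Finset.mem_erase.2 ⟨hdb, h⟩)
        simp only [κ, if_pos, if_neg hdb, if_neg hdU]
        split_ifs <;> omega))
    rw [Finset.card_erase_of_mem hbU] at this
    have := Finset.card_pos.2 ⟨b, hbU⟩
    omega

theorem exists_suitable_pessimistic {n p : ℕ} (O : Order n p) {j₀ j k : Fin n}
    (hfirst : j = j₀ → ∀ j' i', ∃ i, O.symm (j, i) ≤ O.symm (j', i'))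
    (hk₀ : k = j → n = 1)
    (hk : j ≠ j₀ → ∃ i', ∀ i, O.symm (k, i') < O.symm (j, i)) :
    ∃ R : Preference n p, IsSuitable O j₀ j (constBundle k) .pessimistic R ∧
      R.rank (constBundle j) + ∑ i, numAvailable O j i = n ^ p + p := by
  classical
  rw [← card_singleExchanges]
  set L := singleExchanges O j with hL
  set b : Bundle n p := constBundle j with hb
  set g : Bundle n p := constBundle k with hg
  have hbL : b ∉ L := fun h => by
    obtain ⟨i, x, hx, h⟩ := mem_singleExchanges.1 h
    have := congrFun h i
    rw [Function.update_self] at this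
    rw [← this] at hx
    exact lt_irrefl _ hx
  -- For a single exchange only one summand survives: the number of rounds left from her choice in
  -- that category. Earlier exchanges weigh more.
  let w : Bundle n p → ℕ := fun d => ∑ i, if d i = j then 0 else n * p - (O.symm (j, i) : ℕ)
  have hw : ∀ i x, x ≠ j → w (Function.update b i x) = n * p - (O.symm (j, i) : ℕ) := by
    intro i x hx
    simp only [w]
    rw [Finset.sum_eq_single i]
    · rw [Function.update_self, if_neg hx]
    · intro i' _ hi'
      rw [Function.update_of_ne hi']
      exact if_pos rfl
    · simp
  -- The factor 2 leaves room to put `g` ahead of bundles of equal weight without disturbing the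
  -- order of different weights.
  let κ : Bundle n p → ℕ := fun d =>
    if d = b then 4 else if d ∈ L then 5 + 2 * w d + (if d = g then 0 else 1) else
      if d = g then 0 else 3
  obtain ⟨R, hR⟩ := exists_preference_of_key κ
  have htop : g ≠ b → g ∉ L → R.rank g = 1 := fun hgb hgL => by
    refine R.rank_eq_one fun d hd => hR _ _ ?_
    simp only [κ, if_neg hgb, if_neg hgL, if_pos, if_neg hd]
    split_ifs <;> omega
  -- A constant bundle other than `b` differs from it everywhere, so it is a single exchange only if
  -- there is exactly one category.
  have hgL : ∀ i, k ≠ j → g ∈ L → (∀ i', i' = i) ∧ O.symm (j, i) < O.symm (k, i) := by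
    intro i hkj h
    obtain ⟨i₁, x, hx, h⟩ := mem_singleExchanges.1 h
    have hi₁ : ∀ i', i' = i₁ := fun i' => by
      by_contra hne
      have := congrFun h i'
      rw [Function.update_of_ne hne] at this
      exact hkj this
    have hxk := congrFun h i₁
    rw [Function.update_self] at hxk
    rw [← hxk] at hx
    rw [hi₁ i]
    exact ⟨hi₁, hx⟩
  have hone : j ≠ j₀ → R.rank g = 1 := fun hj => by
    obtain ⟨i', hi'⟩ := hk hj
    have hkj : k ≠ j := by
      rintro rfl
      exact lt_irrefl _ (hi' i')
    exact htop (fun h => hkj (congrFun h i')) fun h =>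
      lt_asymm (hgL i' hkj h).2 (hi' i')
  refine ⟨R, ⟨fun i => ?_, hone, ?_⟩, ?_⟩
  · obtain ⟨d, hd⟩ := R.exists_isWorst
      (S := {d ∈ availableBundles O constBundle (O.symm (j, i)) j | d i = j})
      ⟨b, constBundle_mem O _ j, rfl⟩
    refine ⟨d, hd, fun y hy e he => ?_⟩
    have hylt : O.symm (j, i) < O.symm (y, i) := by
      have := (mem_availableBundles_const.1 he.1.1 i).2 le_rfl
      rw [he.1.2] at this
      exact lt_of_le_of_ne this fun h => hy (symm_inj h).1.symm
    have hmem : Function.update b i y ∈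
        {d ∈ availableBundles O constBundle (O.symm (j, i)) j | d i = y} := by
      refine ⟨mem_availableBundles_const.2 fun i' => ?_, Function.update_self ..⟩
      by_cases h : i' = i
      · subst h
        rw [Function.update_self]
        exact ⟨fun h => absurd h (lt_irrefl _), fun _ => hylt.le⟩
      · rw [Function.update_of_ne h]
        exact ⟨fun _ => rfl, id⟩
    have hyL : Function.update b i y ∈ L := mem_singleExchanges.2 ⟨i, y, hylt, rfl⟩
    have hyb : Function.update b i y ≠ b := fun h => hbL (h ▸ hyL)
    -- The worst bundle `d` with item `j` is either outside `L`, hence at least as good as `b`, or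
    -- an exchange in a category chosen after `i`, hence lighter than the exchange of `y` in `i`.
    have hpref : R.prefers d (Function.update b i y) := by
      refine hR _ _ ?_
      have hκ : 5 + 2 * (n * p - (O.symm (j, i) : ℕ)) ≤ κ (Function.update b i y) := by
        simp only [κ, if_neg hyb, if_pos hyL, hw i y hy]
        omega
      refine lt_of_lt_of_le ?_ hκ
      simp only [κ]
      split_ifs with h1 h2 h3 h3
      · omega
      all_goals try omega
      all_goals
        obtain ⟨i', x, hx, hdx⟩ := mem_singleExchanges.1 h2
        have hxj : x ≠ j := by
          rintro rfl
          exact lt_irrefl _ hx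
        have hdi' : d i' = x := by rw [hdx, Function.update_self]
        have hle : O.symm (j, i) ≤ O.symm (j, i') := by
          by_contra hlt
          exact hxj (hdi'.symm.trans ((mem_availableBundles_const.1 hd.1.1 i').1 (not_le.1 hlt)))
        have hlt : O.symm (j, i) < O.symm (j, i') := lt_of_le_of_ne hle fun h => by
          rw [(symm_inj h).2] at hd
          exact hxj (hdi'.symm.trans hd.1.2)
        have hwd : w d = n * p - (O.symm (j, i') : ℕ) := by rw [hdx]; exact hw i' x hxj
        have := (O.symm (j, i')).isLt
        rw [Fin.lt_def] at hlt
        omega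
    by_cases hey : Function.update b i y = e
    · exact hey ▸ hpref
    · have := R.strictTotal
      exact trans_of R.prefers hpref (he.2 _ hmem hey)
  · by_cases hj : j = j₀
    swap
    · exact Or.inl (hone hj)
    by_cases hkj : k = j
    · have hn := hk₀ hkj
      subst hn
      exact Or.inl (R.rank_eq_one fun d hd => absurd (Subsingleton.elim d g) hd)
    by_cases hmem : g ∈ L
    · obtain ⟨i, x, hx, hgx⟩ := mem_singleExchanges.1 hmem
      obtain ⟨hi, -⟩ := hgL i hkj hmem
      have hgb : g ≠ b := fun h => hkj (congrFun h i)
      have hupd : ∀ d : Bundle n p, d = Function.update b i (d i) := fun d => funext fun i' => by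
        rw [hi i', Function.update_self]
      -- With one category and `j` choosing first, `L` contains every bundle except `b`, all of
      -- equal weight; the tie-break makes `g` second.
      refine R.rank_eq_one_or_two (e := b) fun d hdg hdb => hR _ _ ?_
      have hdi : d i ≠ j := fun h => hdb (funext fun i' => by rw [hi i', h]; rfl)
      have hdL : d ∈ L := mem_singleExchanges.2 ⟨i, d i, by
        obtain ⟨i', hi'⟩ := hfirst hj (d i) i
        rw [hi i'] at hi'
        exact lt_of_le_of_ne hi' fun h => hdi (symm_inj h).1.symm, hupd d⟩
      have hwg : w g = w d := by
        rw [hupd g, hupd d, hw i (g i) hkj, hw i _ hdi]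
      simp only [κ, if_neg hgb, if_pos hmem, if_pos, if_neg hdb, if_pos hdL, if_neg hdg, hwg]
      omega
    · rcases Nat.eq_zero_or_pos p with rfl | hp
      · exact Or.inl (R.rank_eq_one fun d hd => absurd (Subsingleton.elim d g) hd)
      · exact Or.inl (htop (fun h => hkj (congrFun h ⟨0, hp⟩)) hmem)
  · have := R.rank_add_card (b := b) hbL
      (fun d hd => hR _ _ (by
        have hdb : d ≠ b := fun h => hbL (h ▸ hd)
        simp only [κ, if_pos, if_neg hdb, if_pos hd]
        omega))
      (fun d hd hdb => hR _ _ (by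
        simp only [κ, if_pos, if_neg hdb, if_neg hd]
        split_ifs <;> omega))
    omega

/-! ### Assembling the profile -/

/-- Apply `exists_perm_lt` to the rounds of the agents' first choices. -/
theorem exists_first_agent_perm {n p : ℕ} (hn : 1 ≤ n) (hp : 1 ≤ p) (O : Order n p) :
    ∃ (j₀ : Fin n) (σ : Equiv.Perm (Fin n)),
      (∀ j' i', ∃ i, O.symm (j₀, i) ≤ O.symm (j', i')) ∧ (σ j₀ = j₀ → n = 1) ∧
      ∀ j, j ≠ j₀ → ∃ i', ∀ i, O.symm (σ j, i') < O.symm (j, i) := by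
  have : Nonempty (Fin p) := ⟨⟨0, hp⟩⟩
  choose c hc using fun j : Fin n => Finite.exists_min fun i : Fin p => O.symm (j, i)
  obtain ⟨j₀, σ, h1, h2, h3⟩ := exists_perm_lt hn (fun j => O.symm (j, c j))
    fun _ _ h => (symm_inj h).1
  exact ⟨j₀, σ, fun j' i' => ⟨c j₀, (h1 j').trans (hc j' i')⟩, h3,
    fun j hj => ⟨c (σ j), fun i => (h2 j hj).trans_le (hc j i)⟩⟩

end CSAM

theorem theorem2 (n p : ℕ) (hn : 1 ≤ n) (hp : 1 ≤ p) (O : CSAM.Order n p)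
    (τ : Fin n → CSAM.AgentType) :
    ∃ P : CSAM.Profile n p,
      (∀ j : Fin n, τ j = CSAM.AgentType.optimistic →
        ((P j).rank ((CSAM.mechanism O τ P).bundle j) : ℤ) =
          (n : ℤ) ^ p + 1 -
            ∏ l ∈ Finset.univ.filter (fun l : Fin p => CSAM.criticalIndex O j ≤ (l : ℕ)),
              (CSAM.numAvailable O j (CSAM.categoryOrder O j l) : ℤ)) ∧
      (∀ j : Fin n, τ j = CSAM.AgentType.pessimistic →
        ((P j).rank ((CSAM.mechanism O τ P).bundle j) : ℤ) =
          (n : ℤ) ^ p -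
            ∑ l : Fin p, ((CSAM.numAvailable O j (CSAM.categoryOrder O j l) : ℤ) - 1)) ∧
      ∃ A : CSAM.Allocation n p, ∃ j₀ : Fin n,
        (∀ j : Fin n, j ≠ j₀ → (P j).rank (A.bundle j) = 1) ∧
        ((P j₀).rank (A.bundle j₀) = 1 ∨ (P j₀).rank (A.bundle j₀) = 2) := by
  obtain ⟨j₀, σ, hfirst, hσ₀, hσ⟩ := CSAM.exists_first_agent_perm hn hp O
  have key : ∀ j, ∃ R : CSAM.Preference n p,
      CSAM.IsSuitable O j₀ j (CSAM.constBundle (σ j)) (τ j) R ∧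
      (τ j = CSAM.AgentType.optimistic → R.rank (CSAM.constBundle j) +
        ∏ l ∈ Finset.univ.filter (fun l : Fin p => CSAM.criticalIndex O j ≤ (l : ℕ)),
          CSAM.numAvailable O j (CSAM.categoryOrder O j l) = n ^ p + 1) ∧
      (τ j = CSAM.AgentType.pessimistic → R.rank (CSAM.constBundle j) +
        ∑ i, CSAM.numAvailable O j i = n ^ p + p) := by
    intro j
    have hf : j = j₀ → ∀ j' i', ∃ i, O.symm (j, i) ≤ O.symm (j', i') := fun h => h ▸ hfirst
    have hk₀ : σ j = j → n = 1 := fun h => by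
      by_cases hj : j = j₀
      · exact hσ₀ (hj ▸ h)
      · obtain ⟨i', hi'⟩ := hσ j hj
        have := hi' i'
        rw [h] at this
        exact absurd this (lt_irrefl _)
    cases hτ : τ j with
    | optimistic =>
      obtain ⟨R, h1, h2⟩ := CSAM.exists_suitable_optimistic hp O hf hk₀ (hσ j)
      exact ⟨R, h1, fun _ => h2, nofun⟩
    | pessimistic =>
      obtain ⟨R, h1, h2⟩ := CSAM.exists_suitable_pessimistic O hf hk₀ (hσ j)
      exact ⟨R, h1, nofun, fun _ => h2⟩
  choose P hP hopt hpes using key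
  -- Suitability refers only to the agent's own preference along the intended run, so the separately
  -- chosen preferences fit together; uniqueness of runs then identifies the outcome.
  have hrun : CSAM.IsRun O τ P CSAM.constBundle := fun j i => (hP j).1 i
  refine ⟨P, ?_, ?_, ⟨fun j => CSAM.constBundle (σ j), fun _ => σ.surjective⟩, j₀,
    fun j hj => (hP j).2.1 hj, (hP j₀).2.2⟩
  · intro j hj
    rw [CSAM.mechanism_bundle_eq hrun]
    have := congrArg (Nat.cast : ℕ → ℤ) (hopt j hj)
    push_cast at this
    linarith
  · intro j hj
    rw [CSAM.mechanism_bundle_eq hrun]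
    have h1 := hpes j hj
    rw [← Equiv.sum_comp (CSAM.categoryOrder O j)] at h1
    zify at h1
    rw [Finset.sum_sub_distrib]
    simp only [Finset.sum_const, Finset.card_univ, Fintype.card_fin, nsmul_eq_mul, mul_one]
    linarith
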